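/- For $R\subseteq\mathbb N=\{1,2,\dots\}$ and $n,k\ge 1$ let ${n\brace k}_R$ be the number of partitions of $[n]=\{1,\dots,n\}$ into $k$ non-empty blocks whose sizes all lie in $R$. When the infinite matrix $\left[{n\brace k}_R\right]_{n,k\ge1}$ has an inverse, let ${n\brace k}_R^{-1}$ be the entry in row $n$ and column $k$ of that inverse. (Matrices here are row-finite integer matrices, i.e. every row has only finitely many non-zero entries, and inverses are two-sided.) In a plane rooted tree with integer-labeled leaves, let $\ell(v)$ denote the largest label of a leaf descended from $v$ (or equal to $v$). Let ${\cal H}(n,k)$ be the set of forests consisting of an unordered collection of $k$ plane rooted trees with $n$ leaves in total (an isolated root counts as a leaf), in which every non-leaf has at least two children, and whose leaves are labeled bijectively with $1,\dots,n$ in such a way that $\ell$ increases from left to right across each set of siblings. For each of the restriction sets $R$ below, the matrix $\left[{n\brace k}_R\right]_{n,k\ge1}$ has a unique inverse, and for all $n,k\ge1$: 1. Let $r\ge1$. Then ${n\brace k}^{-1}_{\{1,2,\dots,2r\}}$ is $(-1)^{n-k}$ times the number of forests in ${\cal H}(n,k)$ in which each vertex $v$ has $0$ or $2$ children, unless $v$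 is the left-most child of a vertex with two children, in which case $v$ has $0$ or $2r$ children. 2. Let $r\ge1$ and $d\ge2$. If $n\equiv k\pmod d$, then ${n\brace k}^{-1}_{\{1,d+1,2d+1,\dots,1+(2r-1)d\}}$ is $(-1)^{(n-k)/d}$ times the number of forests in ${\cal H}(n,k)$ in which each vertex $v$ has $0$ or $d+1$ children, unless $v$ is the left-most child of a vertex with $d+1$ children, in which case $v$ has $0$ or $1+(2r-1)d$ children. If $n\not\equiv k\pmod d$, then this number is $0$. 3. Let $d\ge1$. If $n\equiv k\pmod d$, then ${n\brace k}^{-1}_{\{1,d+1,2d+1,\dots\}}$ is $(-1)^{(n-k)/d}$ times the number of forests in ${\cal H}(n,k)$ in which each vertex has $0$ or $d+1$ children and every left-most child is a leaf. If $n\not\equiv k\pmod d$, then this number is $0$. -/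

import Mathlib

/-- The `R`-restricted Stirling number of the second kind: the number of partitions of
`{1, …, n}` into `k` non-empty blocks whose cardinalities all lie in `R`. -/
noncomputable def restrictedStirling (R : Set ℕ) (n k : ℕ) : ℕ :=
  Nat.card {P : Finpartition (Finset.Icc 1 n) //
    P.parts.card = k ∧ ∀ b ∈ P.parts, b.card ∈ R}

/-- The infinite matrix of restricted Stirling numbers (row index `n ≥ 1`, column index
`k ≥ 1`). -/
noncomputable def restrictedStirlingMatrix (R : Set ℕ) : Matrix ℕ+ ℕ+ ℤ :=
  fun n k => (restrictedStirling R n k : ℤ)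

/-- `B` is a two-sided inverse of `A` in the ring of row-finite infinite integer matrices.
By row-finiteness all the sums below have only finitely many non-zero terms. -/
structure IsInverseMatrix (A B : Matrix ℕ+ ℕ+ ℤ) : Prop where
  rowFinite_left : ∀ n, {j | A n j ≠ 0}.Finite
  rowFinite_right : ∀ n, {j | B n j ≠ 0}.Finite
  mul_right : ∀ n k, ∑ᶠ j, A n j * B j k = if n = k then 1 else 0
  mul_left : ∀ n k, ∑ᶠ j, B n j * A j k = if n = k then 1 else 0

open Classical in
/-- The inverse `R`-restricted Stirling number of the second kind: the `(n, k)` entry of the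
inverse of the matrix of restricted Stirling numbers (and `0` if there is no inverse). -/
noncomputable def inverseRestrictedStirling (R : Set ℕ) (n k : ℕ+) : ℤ :=
  if h : ∃ B, IsInverseMatrix (restrictedStirlingMatrix R) B then h.choose n k else 0

/-- Plane rooted trees whose leaves carry natural number labels. The children of
`node m child` are, from left to right, `child 0, …, child (m - 1)`. -/
inductive LeafLabeledTree : Type
  | leaf (label : ℕ) : LeafLabeledTree
  | node (m : ℕ) (child : Fin m → LeafLabeledTree) : LeafLabeledTree

namespace LeafLabeledTree

/-- The multiset of leaf labels. -/
def leafLabels : LeafLabeledTree → Multiset ℕ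
  | leaf a => {a}
  | node _ child => ∑ i, (child i).leafLabels

/-- The label `ℓ(v)` of the root `v` of a tree: the largest label of a leaf descended
from it. -/
def maxLabel : LeafLabeledTree → ℕ
  | leaf a => a
  | node _ child => Finset.univ.sup fun i => (child i).maxLabel

/-- Every non-leaf vertex has at least two children, and across each set of siblings the
label `ℓ` increases from left to right. -/
def IsIncreasing : LeafLabeledTree → Prop
  | leaf _ => True
  | node m child =>
      2 ≤ m ∧ (StrictMono fun i => (child i).maxLabel) ∧ ∀ i, (child i).IsIncreasing

/-- `t.DegreesIn A S B restricted`: the number of children of each vertex `v` of `t` lies in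
`A`, unless `v` is the left-most child of a vertex whose number of children lies in `S`, in
which case the number of children of `v` lies in `B`. The argument `restricted` says whether
the root of `t` is itself such a left-most child in the tree that contains `t`. -/
def DegreesIn (A S B : Set ℕ) : LeafLabeledTree → (restricted : Prop) → Prop
  | leaf _, restricted => (¬restricted → 0 ∈ A) ∧ (restricted → 0 ∈ B)
  | node m child, restricted =>
      (¬restricted → m ∈ A) ∧ (restricted → m ∈ B) ∧
        ∀ i, (child i).DegreesIn A S B (i.val = 0 ∧ m ∈ S)

end LeafLabeledTree

/-- The set `H(n, k)` of forests, i.e. unordered collections of `k` leaf-labelled plane rooted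
trees with `n` leaves in total, labelled bijectively by `1, …, n`, such that all non-leaves
have at least two children and `ℓ` increases from left to right across each set of
siblings. -/
def forestsH (n k : ℕ) : Set (Multiset LeafLabeledTree) :=
  {F | F.card = k ∧ (F.map LeafLabeledTree.leafLabels).sum = (Finset.Icc 1 n).val ∧
    ∀ t ∈ F, t.IsIncreasing}

/-- The number of forests in `H(n, k)` in which the number of children of each vertex `v` lies
in `A`, unless `v` is the left-most child of a vertex whose number of children lies in `S`, in
which case it lies in `B`. Roots of the forest are not children of any vertex. -/
noncomputable def forestCount (A S B : Set ℕ) (n k : ℕ) : ℕ :=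
  {F ∈ forestsH n k | ∀ t ∈ F, t.DegreesIn A S B False}.ncard

/-! Put f = Σ_{m∈R} x^m/m!. Then n brace k restricted to R is n!/k! · [x^n] f^k. Arrays of this
shape multiply as their series compose, so it suffices to show that the signed forest numbers form
the array of some T with f∘T = X.

Siblings, and the trees of a forest, are determined by their set once they are sorted by largest
label. Hence forests are counted by T^k/k!, where T is the exponential generating function of
unrestricted trees. The sign is carried by a complex ζ with ζ^d = -1: an object made of k trees with
n leaves has weight ζ^(n-k), which is (-1)^((n-k)/d) whenever n ≡ k mod d.

Let M_j be the weighted series of ordered sequences of j trees whose first tree is restricted. The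
largest label lies in the last tree, so M_{j+1}' = T'·M_j for j ≥ 1. As an inner node of an
unrestricted tree has d+1 children, M_{d+1} = X - T. On the other side let g_j = Σ_{i∈I}
x^(j+id)/(j+id)!, with I chosen so that g_{d+1} = f - X; then g_{j+1}' = g_j. With E = f - g_1 and
M_1 = X - E∘T, the differences D_j = g_j∘T - M_j satisfy D_{j+1}' = T'·D_j and D_1 = f∘T - X =
D_{d+1}. Each integration raises the order of vanishing, so D_1 = 0
(`subst_eq_X_of_iterated_integrals`).

It remains to check M_1 = X - E∘T. For finite R, E is the single top term x^m/m!, and restricted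
nodes have m children. For infinite R, E = 0 and restricted vertices are leaves. -/

/-! ### Sequences of labelled objects -/

/-- Sequences of `j` objects, the `i`-th one in the class `K i`, whose label multisets together
exhaust `s`, and whose largest labels increase. -/
def orderedSeqs {α : Type*} (lab : α → Multiset ℕ) (K : ℕ → Set α) (j : ℕ) (s : Finset ℕ) :
    Set (Fin j → α) :=
  {c | StrictMono (fun i => (lab (c i)).sup) ∧ ∑ i, lab (c i) = s.val ∧ ∀ i : Fin j, c i ∈ K i}

/-- The number of ordered sequences of `j` objects with `n` labels, if there are `κ i n` objects
with `n` labels in the `i`-th class. -/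
def seqCount (κ : ℕ → ℕ → ℕ) : ℕ → ℕ → ℕ
  | 0, n => if n = 0 then 1 else 0
  | _ + 1, 0 => 0
  | j + 1, n + 1 =>
      ∑ i ∈ Finset.range (n + 1), n.choose i * (κ j (i + 1) * seqCount κ j (n - i))

theorem Multiset.sup_mem_of_ne_zero {m : Multiset ℕ} (hm : m ≠ 0) : m.sup ∈ m := by
  induction m using Multiset.induction with
  | empty => exact absurd rfl hm
  | cons a t ih =>
    rw [Multiset.sup_cons]
    by_cases ht : t = 0
    · simp [ht]
    · rcases le_total a t.sup with h | h
      · rw [sup_eq_right.2 h]; exact Multiset.mem_cons_of_mem (ih ht)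
      · rw [sup_eq_left.2 h]; exact Multiset.mem_cons_self _ _

section orderedSeqs

variable {α : Type*} {lab : α → Multiset ℕ} {K : ℕ → Set α}

theorem orderedSeqs_zero_empty : orderedSeqs lab K 0 ∅ = Set.univ := by
  ext c
  simp [orderedSeqs, StrictMono]

theorem orderedSeqs_zero_of_nonempty {s : Finset ℕ} (hs : s.Nonempty) :
    orderedSeqs lab K 0 s = ∅ := by
  ext c
  simp only [orderedSeqs, Set.mem_ofPred_eq, Set.mem_empty_iff_false, iff_false]
  rintro ⟨-, h, -⟩
  simp only [Finset.univ_eq_empty, Finset.sum_empty] at h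
  exact hs.ne_empty (Finset.val_eq_zero.1 h.symm)

theorem orderedSeqs_succ_empty (hK : ∀ i, ∀ x ∈ K i, lab x ≠ 0) (j : ℕ) :
    orderedSeqs lab K (j + 1) ∅ = ∅ := by
  ext c
  simp only [orderedSeqs, Set.mem_ofPred_eq, Set.mem_empty_iff_false, iff_false]
  rintro ⟨-, h, hc⟩
  simp only [Finset.empty_val, Finset.sum_eq_zero_iff, Finset.mem_univ, true_imp_iff] at h
  exact hK _ _ (hc 0) (h 0)

/-- Largest labels increase, so the maximum M of s belongs to the last object. Its remaining labels
form an arbitrary b, and the earlier objects form a shorter sequence on what is left. Conversely,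
any such last object may be appended, since the earlier ones only have labels below M. -/
theorem orderedSeqs_succ (hK : ∀ i, ∀ x ∈ K i, lab x ≠ 0) (j : ℕ) {s : Finset ℕ}
    (hs : s.Nonempty) :
    orderedSeqs lab K (j + 1) s = ⋃ b ∈ (s.erase (s.max' hs)).powerset,
      (fun p : (Fin j → α) × α => (Fin.snoc p.1 p.2 : Fin (j + 1) → α)) ''
        (orderedSeqs lab K j (s \ insert (s.max' hs) b) ×ˢ
          {x ∈ K j | lab x = (insert (s.max' hs) b).val}) := by
  set M := s.max' hs with hM
  have hMs : M ∈ s := s.max'_mem hs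
  ext c
  simp only [Set.mem_iUnion, Finset.mem_powerset, Set.mem_image, Set.mem_prod, Set.mem_ofPred_eq,
    Prod.exists, exists_prop]
  constructor
  · rintro ⟨hmono, hsum, hc⟩
    have hle : ∀ i, lab (c i) ≤ s.val := fun i => by
      rw [← hsum]; exact Finset.single_le_sum (f := fun i => lab (c i)) (fun _ _ => zero_le)
        (Finset.mem_univ i)
    have hsup : ∀ i, (lab (c i)).sup ≤ M := fun i =>
      Multiset.sup_le.2 fun a ha => s.le_max' a (Multiset.mem_of_le (hle i) ha)
    have hlast : M ∈ lab (c (Fin.last j)) := by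
      have : M ∈ ∑ i, lab (c i) := by rw [hsum]; exact hMs
      obtain ⟨i, -, hi⟩ := Multiset.mem_sum.1 this
      rcases eq_or_ne i (Fin.last j) with rfl | hne
      · exact hi
      · have h1 := hmono (Fin.lt_last_iff_ne_last.2 hne)
        have h2 := Multiset.le_sup hi
        have h3 := hsup (Fin.last j)
        simp only at h1
        omega
    have hnd : (lab (c (Fin.last j))).Nodup := Multiset.nodup_of_le (hle _) s.nodup
    set B : Finset ℕ := ⟨lab (c (Fin.last j)), hnd⟩ with hB
    have hBM : M ∈ B := hlast
    have hBs : B ⊆ s := fun a ha => Multiset.mem_of_le (hle (Fin.last j)) ha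
    refine ⟨B.erase M, Finset.erase_subset_erase _ hBs, fun i => c i.castSucc, c (Fin.last j), ?_,
      ?_⟩
    · rw [Finset.insert_erase hBM]
      refine ⟨⟨fun a b hab => hmono (by simpa using hab), ?_, fun i => by simpa using hc i.castSucc⟩,
        by simpa using hc (Fin.last j), rfl⟩
      rw [Fin.sum_univ_castSucc] at hsum
      rw [Finset.sdiff_val, ← hsum]
      simp [hB]
    · exact Fin.snoc_init_self c
  · rintro ⟨b, hb, c, x, ⟨⟨hmono, hsum, hc⟩, hx, hlab⟩, rfl⟩
    have hsub : insert M b ⊆ s :=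
      Finset.insert_subset hMs (hb.trans (Finset.erase_subset _ _))
    have hlt : ∀ i, (lab (c i)).sup < M := fun i => by
      have hmem := Multiset.sup_mem_of_ne_zero (hK _ _ (hc i))
      have : (lab (c i)).sup ∈ s \ insert M b := by
        rw [← Finset.mem_val, ← hsum]
        exact Multiset.mem_sum.2 ⟨i, Finset.mem_univ _, hmem⟩
      rw [Finset.mem_sdiff, Finset.mem_insert, not_or] at this
      exact lt_of_le_of_ne (s.le_max' _ this.1) this.2.1
    have hxM : M ≤ (lab x).sup := Multiset.le_sup (by rw [hlab]; simp)
    refine ⟨fun a a' haa => ?_, ?_, fun i => ?_⟩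
    · induction a using Fin.lastCases with
      | last => exact absurd haa (Fin.le_last a').not_gt
      | cast a =>
        induction a' using Fin.lastCases with
        | last => simpa using (hlt a).trans_le hxM
        | cast a' => simpa using hmono (by simpa using haa)
    · rw [Fin.sum_univ_castSucc]
      simp only [Fin.snoc_castSucc, Fin.snoc_last, hsum, hlab]
      rw [Finset.sdiff_val]
      exact tsub_add_cancel_of_le (Finset.val_le_iff.2 hsub)
    · induction i using Fin.lastCases with
      | last => simpa using hx
      | cast i => simpa using hc i

/-- The number of ordered sequences on a label set only depends on the size of the label set. -/
theorem orderedSeqs_finite_and_ncard {κ : ℕ → ℕ → ℕ} (hK : ∀ i, ∀ x ∈ K i, lab x ≠ 0)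
    (hκ : ∀ i, ∀ s : Finset ℕ, {x ∈ K i | lab x = s.val}.Finite ∧
      {x ∈ K i | lab x = s.val}.ncard = κ i s.card) (j : ℕ) (s : Finset ℕ) :
    (orderedSeqs lab K j s).Finite ∧ (orderedSeqs lab K j s).ncard = seqCount κ j s.card := by
  induction j generalizing s with
  | zero =>
    refine ⟨Set.toFinite _, ?_⟩
    rcases s.eq_empty_or_nonempty with rfl | hs
    · rw [orderedSeqs_zero_empty, Set.ncard_univ]; simp [seqCount]
    · rw [orderedSeqs_zero_of_nonempty hs]; simp [seqCount, hs.ne_empty]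
  | succ j ih =>
    rcases s.eq_empty_or_nonempty with rfl | hs
    · rw [orderedSeqs_succ_empty hK]; simp [seqCount]
    · rw [orderedSeqs_succ hK j hs]
      set M := s.max' hs with hM
      have hMs : M ∈ s := s.max'_mem hs
      have hinj : Function.Injective
          (fun p : (Fin j → α) × α => (Fin.snoc p.1 p.2 : Fin (j + 1) → α)) := by
        rintro ⟨c, x⟩ ⟨c', x'⟩ h
        obtain ⟨h1, h2⟩ := Fin.snoc_inj.1 h
        exact Prod.ext h1 h2
      have hfin : ∀ b ∈ ((s.erase M).powerset : Set (Finset ℕ)),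
          ((fun p : (Fin j → α) × α => (Fin.snoc p.1 p.2 : Fin (j + 1) → α)) ''
        (orderedSeqs lab K j (s \ insert M b) ×ˢ
          {x ∈ K j | lab x = (insert M b).val})).Finite := fun b _ =>
        ((ih _).1.prod (hκ _ _).1).image _
      refine ⟨Set.Finite.biUnion (Finset.finite_toSet _) hfin, ?_⟩
      refine (Set.Finite.ncard_biUnion (Finset.finite_toSet _) hfin ?_).trans ?_
      · intro b hb b' hb' hne
        rw [Function.onFun, Set.disjoint_left]
        rintro _ ⟨⟨c, x⟩, ⟨-, -, hx⟩, rfl⟩ ⟨⟨c', x'⟩, ⟨-, -, hx'⟩, he⟩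
        have hxx : x' = x := (Prod.ext_iff.1 (hinj he)).2
        simp only at hx hx'
        rw [hxx, hx] at hx'
        have hi : insert M b = insert M b' := Finset.val_injective hx'
        have hMb : M ∉ b := fun h => by simpa using Finset.mem_powerset.1 hb h
        have hMb' : M ∉ b' := fun h => by simpa using Finset.mem_powerset.1 hb' h
        exact hne (by rw [← Finset.erase_insert hMb, hi, Finset.erase_insert hMb'])
      · rw [finsum_mem_coe_finset]
        obtain ⟨n, hn⟩ : ∃ n, s.card = n + 1 := ⟨s.card - 1, by have := hs.card_pos; omega⟩
        have hne : (s.erase M).card = n := by rw [Finset.card_erase_of_mem hMs, hn]; rfl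
        rw [hn, seqCount]
        -- Grouping the sets b by cardinality produces the binomial coefficients of `seqCount`.
        have := Finset.sum_powerset_apply_card (x := s.erase M)
          (fun i => κ j (i + 1) * seqCount κ j (n - i))
        simp only [hne, smul_eq_mul] at this
        rw [← this]
        refine Finset.sum_congr rfl fun b hb => ?_
        rw [Finset.mem_powerset] at hb
        have hMb : M ∉ b := fun h => by simpa using hb h
        have hsub : insert M b ⊆ s :=
          Finset.insert_subset hMs (hb.trans (Finset.erase_subset _ _))
        rw [Set.ncard_image_of_injective _ hinj, Set.ncard_prod, (ih _).2, (hκ _ _).2,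
          Finset.card_sdiff_of_subset hsub, Finset.card_insert_of_notMem hMb, hn, mul_comm]
        congr 2
        omega

end orderedSeqs

/-! ### Unordered collections of labelled objects -/

/-- Multisets of `k` objects in the class `P` whose label multisets together exhaust `s`. -/
def labelledMultisets {α : Type*} (lab : α → Multiset ℕ) (P : Set α) (k : ℕ) (s : Finset ℕ) :
    Set (Multiset α) :=
  {F | F.card = k ∧ (F.map lab).sum = s.val ∧ ∀ x ∈ F, x ∈ P}

section labelledMultisets

variable {α : Type*} {lab : α → Multiset ℕ} {P : Set α}

/-- The label multisets are non-empty and add up to a set, so they are disjoint and their maxima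
differ. This makes sorting by largest label unambiguous. -/
theorem pairwise_sup_ne_of_mem_labelledMultisets (hP : ∀ x ∈ P, lab x ≠ 0) {k : ℕ} {s : Finset ℕ}
    {F : Multiset α} (hF : F ∈ labelledMultisets lab P k s) :
    F.Pairwise fun x y => (lab x).sup ≠ (lab y).sup := by
  obtain ⟨-, hsum, hmem⟩ := hF
  have h : (F.bind lab).Nodup := by
    have : F.bind lab = s.val := hsum
    rw [this]; exact s.nodup
  obtain ⟨l, rfl, hl⟩ := (Multiset.nodup_bind.1 h).2
  refine ⟨l, rfl, hl.imp_of_mem fun {x y} hx hy hxy he => ?_⟩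
  refine Multiset.disjoint_left.1 hxy (Multiset.sup_mem_of_ne_zero (hP _ (hmem _ hx))) ?_
  rw [he]
  exact Multiset.sup_mem_of_ne_zero (hP _ (hmem _ hy))

theorem bijOn_orderedSeqs_labelledMultisets (hP : ∀ x ∈ P, lab x ≠ 0) (k : ℕ) (s : Finset ℕ) :
    Set.BijOn (fun c : Fin k → α => (List.ofFn c : Multiset α))
      (orderedSeqs lab (fun _ => P) k s) (labelledMultisets lab P k s) := by
  have hsort : ∀ c ∈ orderedSeqs lab (fun _ => P) k s,
      (List.ofFn c).Pairwise fun x y => (lab x).sup < (lab y).sup := by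
    intro c hc
    rw [List.pairwise_ofFn]
    exact fun i j hij => hc.1 hij
  refine ⟨?_, ?_, ?_⟩
  · rintro c ⟨-, hsum, hc⟩
    refine ⟨by simp, ?_, ?_⟩
    · rw [Multiset.map_coe, List.map_ofFn, Multiset.sum_coe, List.sum_ofFn]
      exact hsum
    · intro x hx
      rw [Multiset.mem_coe, List.mem_ofFn] at hx
      obtain ⟨i, rfl⟩ := hx
      exact hc i
  · intro c hc c' hc' h
    refine List.ofFn_injective (List.Perm.eq_of_pairwise
      (le := fun x y => (lab x).sup < (lab y).sup) ?_ (hsort c hc) (hsort c' hc')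
      (Multiset.coe_eq_coe.1 h))
    intro a b _ _ h1 h2
    exact absurd h1 h2.not_gt
  · intro F hF
    obtain ⟨l, rfl, hl⟩ := pairwise_sup_ne_of_mem_labelledMultisets hP hF
    let r : α → α → Prop := fun x y => (lab x).sup ≤ (lab y).sup
    have : Std.Total r := ⟨fun a b => le_total _ _⟩
    have : IsTrans α r := ⟨fun a b c => le_trans⟩
    classical
    set l' := l.insertionSort r with hl'
    have hperm : l'.Perm l := List.perm_insertionSort r l
    have hl2 : l'.Pairwise fun x y => (lab x).sup ≠ (lab y).sup :=
      (hperm.pairwise_iff (fun h => h.symm)).2 hl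
    have hlt : l'.Pairwise fun x y => (lab x).sup < (lab y).sup :=
      ((List.pairwise_insertionSort r l).and hl2).imp fun h => lt_of_le_of_ne h.1 h.2
    have hlen : l'.length = k := by rw [hperm.length_eq]; exact hF.1
    clear_value l'
    subst hlen
    have hcoe : (List.ofFn l'.get : Multiset α) = (l : Multiset α) := by
      rw [List.ofFn_get]; exact Multiset.coe_eq_coe.2 hperm
    refine ⟨l'.get, ⟨?_, ?_, ?_⟩, hcoe⟩
    · exact fun i j hij => List.pairwise_iff_get.1 hlt i j hij
    · rw [← hF.2.1, ← hcoe, Multiset.map_coe, List.map_ofFn, Multiset.sum_coe, List.sum_ofFn]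
      rfl
    · intro i
      exact hF.2.2 _ (by rw [Multiset.mem_coe]; exact hperm.subset (List.get_mem _ _))

theorem labelledMultisets_ncard {κ : ℕ → ℕ} (hP : ∀ x ∈ P, lab x ≠ 0)
    (hκ : ∀ s : Finset ℕ, {x ∈ P | lab x = s.val}.Finite ∧
      {x ∈ P | lab x = s.val}.ncard = κ s.card) (k : ℕ) (s : Finset ℕ) :
    (labelledMultisets lab P k s).ncard = seqCount (fun _ => κ) k s.card := by
  have h := bijOn_orderedSeqs_labelledMultisets hP k s
  rw [← h.image_eq, h.injOn.ncard_image,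
    (orderedSeqs_finite_and_ncard (K := fun _ => P) (fun _ => hP) (fun _ => hκ) k s).2]

end labelledMultisets

/-! ### Partitions as multisets of blocks -/

theorem restrictedStirling_eq_labelledMultisets_ncard (R : Set ℕ) (n k : ℕ) :
    restrictedStirling R n k =
      (labelledMultisets Finset.val {b : Finset ℕ | b.Nonempty ∧ b.card ∈ R} k
        (Finset.Icc 1 n)).ncard := by
  rw [restrictedStirling, ← Nat.card_coe_set_eq]
  have hmem : ∀ P : Finpartition (Finset.Icc 1 n), (P.parts.card = k ∧ ∀ b ∈ P.parts, b.card ∈ R) →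
      P.parts.val ∈ labelledMultisets Finset.val {b : Finset ℕ | b.Nonempty ∧ b.card ∈ R} k
        (Finset.Icc 1 n) := by
    rintro P ⟨hk, hR⟩
    refine ⟨hk, ?_, fun b hb => ⟨P.nonempty_of_mem_parts hb, hR b hb⟩⟩
    have h1 : P.parts.disjiUnion id P.disjoint = Finset.Icc 1 n := by
      rw [Finset.disjiUnion_eq_biUnion, P.biUnion_parts]
    exact congrArg Finset.val h1
  refine Nat.card_congr (Equiv.ofBijective (fun P => ⟨P.1.parts.val, hmem P.1 P.2⟩) ⟨?_, ?_⟩)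
  · intro P Q h
    have h1 : P.1.parts.val = Q.1.parts.val := congrArg Subtype.val h
    exact Subtype.ext (Finpartition.ext (Finset.val_injective h1))
  · rintro ⟨F, hk, hsum, hF⟩
    have hbind : F.bind Finset.val = (Finset.Icc 1 n).val := hsum
    have hnd : (F.bind Finset.val).Nodup := by rw [hbind]; exact Finset.nodup _
    obtain ⟨l, rfl, hl⟩ := (Multiset.nodup_bind.1 hnd).2
    have hne : l.Pairwise (· ≠ ·) := hl.imp_of_mem fun {x y} hx hy hxy he => by
      obtain ⟨a, ha⟩ := (hF x hx).1
      exact Multiset.disjoint_left.1 hxy ha (he ▸ ha)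
    have hFnd : (l : Multiset (Finset ℕ)).Nodup := hne
    refine ⟨⟨⟨⟨l, hFnd⟩, ?_, ?_, ?_⟩, hk, fun b hb => (hF b hb).2⟩, rfl⟩
    · rw [Finset.supIndep_iff_pairwiseDisjoint]
      intro x hx y hy hxy
      have : Std.Symm (fun x y : Finset ℕ => Disjoint x.val y.val) := ⟨fun _ _ h => h.symm⟩
      exact Finset.disjoint_val.1 (List.Pairwise.forall hl hx hy hxy)
    · ext a
      have := congrArg (fun m => a ∈ m) hbind
      simpa [Finset.mem_sup] using this
    · intro h
      exact Finset.not_nonempty_empty (hF _ h).1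

/-- A block is its own label set, so each label set carries one object or none. -/
theorem restrictedStirling_eq_seqCount (R : Set ℕ) [DecidablePred (· ∈ R)] (n k : ℕ) :
    restrictedStirling R n k = seqCount (fun _ i => if i ≠ 0 ∧ i ∈ R then 1 else 0) k n := by
  rw [restrictedStirling_eq_labelledMultisets_ncard,
    labelledMultisets_ncard (κ := fun i => if i ≠ 0 ∧ i ∈ R then 1 else 0)
      (fun b hb => by simpa using hb.1.ne_empty) ?_, Nat.card_Icc, Nat.add_sub_cancel]
  intro s
  have h : {x ∈ {b : Finset ℕ | b.Nonempty ∧ b.card ∈ R} | x.val = s.val} =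
      if s.card ≠ 0 ∧ s.card ∈ R then {s} else ∅ := by
    ext x
    split_ifs with hs
    · constructor
      · exact fun hx => Finset.val_injective hx.2
      · rintro rfl
        exact ⟨⟨Finset.card_ne_zero.1 hs.1, hs.2⟩, rfl⟩
    · simp only [Set.mem_empty_iff_false, iff_false]
      rintro ⟨⟨h1, h2⟩, h3⟩
      rw [Finset.val_injective h3] at h1 h2
      exact hs ⟨h1.card_ne_zero, h2⟩
  rw [h]
  split_ifs <;> simp

/-! ### Counting trees -/

namespace LeafLabeledTree

theorem sup_leafLabels (t : LeafLabeledTree) : t.leafLabels.sup = t.maxLabel := by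
  induction t with
  | leaf a => simp [leafLabels, maxLabel]
  | node m c ih =>
    simp only [leafLabels, maxLabel, ← ih]
    refine le_antisymm (Multiset.sup_le.2 fun a ha => ?_) (Finset.sup_le fun i _ => ?_)
    · obtain ⟨i, -, hi⟩ := Multiset.mem_sum.1 ha
      exact (Multiset.le_sup hi).trans
        (Finset.le_sup (f := fun i => (c i).leafLabels.sup) (Finset.mem_univ i))
    · exact Multiset.sup_mono fun a ha => Multiset.mem_sum.2 ⟨i, Finset.mem_univ i, ha⟩

theorem IsIncreasing.leafLabels_ne_zero {t : LeafLabeledTree} (ht : t.IsIncreasing) :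
    t.leafLabels ≠ 0 := by
  induction t with
  | leaf a => simp [leafLabels]
  | node m c ih =>
    obtain ⟨hm, -, hc⟩ := ht
    simp only [leafLabels, ne_eq, Finset.sum_eq_zero_iff, Finset.mem_univ, true_imp_iff]
    exact fun h => ih ⟨0, by omega⟩ (hc _) (h _)

/-- The increasing trees satisfying the degree restrictions. -/
def restrictedTrees (A S B : Set ℕ) (ρ : Prop) : Set LeafLabeledTree :=
  {t | t.IsIncreasing ∧ t.DegreesIn A S B ρ}

/-- The number of increasing trees with labels `1, …, n` satisfying the degree restrictions. -/
noncomputable def treeCount (A S B : Set ℕ) (ρ : Prop) (n : ℕ) : ℕ :=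
  {t ∈ restrictedTrees A S B ρ | t.leafLabels = (Finset.Icc 1 n).val}.ncard

variable {A S B : Set ℕ}

theorem leafLabels_ne_zero_of_mem {ρ : Prop} : ∀ t ∈ restrictedTrees A S B ρ, t.leafLabels ≠ 0 :=
  fun _ ht => ht.1.leafLabels_ne_zero

/-- The classes of the subtrees at the children of a vertex with `m` children. -/
abbrev childClass (A S B : Set ℕ) (m : ℕ) (i : ℕ) : Set LeafLabeledTree :=
  restrictedTrees A S B (i = 0 ∧ m ∈ S)

theorem node_mem_restrictedTrees {ρ : Prop} {m : ℕ} {c : Fin m → LeafLabeledTree} {s : Finset ℕ} :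
    (node m c ∈ restrictedTrees A S B ρ ∧ (node m c).leafLabels = s.val) ↔
      2 ≤ m ∧ ((¬ρ → m ∈ A) ∧ (ρ → m ∈ B)) ∧ c ∈ orderedSeqs leafLabels (childClass A S B m) m s := by
  simp only [restrictedTrees, orderedSeqs, Set.mem_ofPred_eq, IsIncreasing, DegreesIn, leafLabels,
    sup_leafLabels, forall_and]
  tauto

/-- `hdeg` says that m is the only possible arity of a non-leaf root, and that non-leaf roots occur
only if `q`. The two summands count the single leaf and the trees with a non-leaf root. -/
theorem restrictedTrees_finite_and_ncard {ρ q : Prop} [Decidable q] {m : ℕ} (hm : 2 ≤ m)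
    (h0 : (¬ρ → 0 ∈ A) ∧ (ρ → 0 ∈ B))
    (hdeg : ∀ k, 2 ≤ k → (((¬ρ → k ∈ A) ∧ (ρ → k ∈ B)) ↔ k = m ∧ q)) (s : Finset ℕ)
    (hfin : (orderedSeqs leafLabels (childClass A S B m) m s).Finite) :
    {t ∈ restrictedTrees A S B ρ | t.leafLabels = s.val}.Finite ∧
      {t ∈ restrictedTrees A S B ρ | t.leafLabels = s.val}.ncard =
        (if s.card = 1 then 1 else 0) +
          if q then (orderedSeqs leafLabels (childClass A S B m) m s).ncard else 0 := by
  have h : {t ∈ restrictedTrees A S B ρ | t.leafLabels = s.val} =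
      leaf '' {a | s = {a}} ∪
        node m '' {c | q ∧ c ∈ orderedSeqs leafLabels (childClass A S B m) m s} := by
    ext t
    cases t with
    | leaf a =>
      have : (({a} : Multiset ℕ) = s.val) ↔ s = {a} := by
        rw [← Finset.singleton_val, Finset.val_inj, eq_comm]
      simpa [restrictedTrees, IsIncreasing, DegreesIn, leafLabels, this] using fun _ => h0
    | node k c =>
      have := node_mem_restrictedTrees (A := A) (S := S) (B := B) (ρ := ρ) (c := c) (s := s)
      rw [Set.mem_ofPred_eq, this]
      constructor
      · rintro ⟨h2, hk, hc⟩
        obtain ⟨rfl, hq⟩ := (hdeg k h2).1 hk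
        exact Or.inr ⟨c, ⟨hq, hc⟩, rfl⟩
      · rintro (⟨a, -, ha⟩ | ⟨c', ⟨hq, hc⟩, he⟩)
        · cases ha
        · cases he
          exact ⟨hm, (hdeg m hm).2 ⟨rfl, hq⟩, hc⟩
  have hleaf : {a | s = {a}}.Finite ∧ {a | s = {a}}.ncard = if s.card = 1 then 1 else 0 := by
    split_ifs with h1
    · obtain ⟨a, rfl⟩ := Finset.card_eq_one.1 h1
      have : {b | ({a} : Finset ℕ) = {b}} = {a} := by ext b; simp [eq_comm]
      rw [this]; simp
    · have : {a | s = {a}} = ∅ := by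
        ext a
        simp only [Set.mem_ofPred_eq, Set.mem_empty_iff_false, iff_false]
        rintro rfl; exact h1 (by simp)
      rw [this]; simp
  have hnode : {c | q ∧ c ∈ orderedSeqs leafLabels (childClass A S B m) m s}.Finite ∧
      {c | q ∧ c ∈ orderedSeqs leafLabels (childClass A S B m) m s}.ncard =
        if q then (orderedSeqs leafLabels (childClass A S B m) m s).ncard else 0 := by
    refine ⟨hfin.subset fun c hc => hc.2, ?_⟩
    split_ifs with hq <;> simp [hq]
  rw [h]
  refine ⟨(hleaf.1.image _).union (hnode.1.image _), ?_⟩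
  rw [Set.ncard_union_eq ?_ (hleaf.1.image _) (hnode.1.image _),
    Set.ncard_image_of_injective _ (fun a b hab => by cases hab; rfl), hleaf.2,
    Set.ncard_image_of_injective _ (fun a b hab => by cases hab; rfl), hnode.2]
  rw [Set.disjoint_left]
  rintro _ ⟨a, -, rfl⟩ ⟨c, -, hc⟩
  cases hc

/-- In a sequence of at least two trees, each tree has fewer leaves than there are labels. -/
theorem orderedSeqs_truncate {α : Type*} {lab : α → Multiset ℕ} {K : ℕ → Set α}
    (hK : ∀ i, ∀ x ∈ K i, lab x ≠ 0) {m : ℕ} (hm : 2 ≤ m) (s : Finset ℕ) :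
    orderedSeqs lab K m s = orderedSeqs lab (fun i => {x ∈ K i | (lab x).card < s.card}) m s := by
  ext c
  simp only [orderedSeqs, Set.mem_ofPred_eq]
  refine ⟨fun ⟨h1, h2, h3⟩ => ⟨h1, h2, fun i => ⟨h3 i, ?_⟩⟩,
    fun ⟨h1, h2, h3⟩ => ⟨h1, h2, fun i => (h3 i).1⟩⟩
  have hcard : s.card = ∑ i, (lab (c i)).card := by
    rw [Finset.card_def, ← h2, Multiset.card_sum]
  have : Nontrivial (Fin m) := Fin.nontrivial_iff_two_le.2 hm
  obtain ⟨j, hj⟩ := exists_ne i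
  rw [hcard]
  exact Finset.single_lt_sum (f := fun i => (lab (c i)).card) hj (Finset.mem_univ i)
    (Finset.mem_univ j) (Multiset.card_pos.2 (hK _ _ (h3 j))) fun _ _ _ => Nat.zero_le _

variable {deg : Prop → ℕ} {q : Prop → Prop}

/-- The number of trees depends only on the number of labels. The induction hypothesis covers only
smaller label sets, whereas `orderedSeqs_finite_and_ncard` wants counts for all of them; truncating
the classes of the children by `orderedSeqs_truncate` bridges this gap. -/
theorem treeCount_spec (hm : ∀ ρ, 2 ≤ deg ρ) (hA : 0 ∈ A) (hB : 0 ∈ B)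
    (hdeg : ∀ ρ k, 2 ≤ k → (((¬ρ → k ∈ A) ∧ (ρ → k ∈ B)) ↔ k = deg ρ ∧ q ρ)) (ρ : Prop)
    (s : Finset ℕ) :
    {t ∈ restrictedTrees A S B ρ | t.leafLabels = s.val}.Finite ∧
      {t ∈ restrictedTrees A S B ρ | t.leafLabels = s.val}.ncard = treeCount A S B ρ s.card := by
  classical
  induction hn : s.card using Nat.strong_induction_on generalizing s ρ with
  | _ n ih =>
    have key : ∀ s' : Finset ℕ, s'.card = n →
        (orderedSeqs leafLabels (childClass A S B (deg ρ)) (deg ρ) s').Finite ∧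
        (orderedSeqs leafLabels (childClass A S B (deg ρ)) (deg ρ) s').ncard =
          seqCount (fun i k => if k < n then treeCount A S B (i = 0 ∧ deg ρ ∈ S) k else 0)
            (deg ρ) n := by
      intro s' hs'
      rw [orderedSeqs_truncate (fun _ => leafLabels_ne_zero_of_mem) (hm ρ), hs']
      have := orderedSeqs_finite_and_ncard (lab := leafLabels)
        (K := fun i => {t ∈ childClass A S B (deg ρ) i | t.leafLabels.card < n})
        (κ := fun i k => if k < n then treeCount A S B (i = 0 ∧ deg ρ ∈ S) k else 0)
        (fun i t ht => leafLabels_ne_zero_of_mem t ht.1) ?_ (deg ρ) s'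
      · rwa [hs'] at this
      intro i u
      by_cases hu : u.card < n
      · have := ih _ hu (i = 0 ∧ deg ρ ∈ S) u rfl
        rw [if_pos hu]
        convert this using 3
        all_goals
          ext t
          simp only [Set.mem_ofPred_eq]
          refine ⟨fun h => ⟨h.1.1, h.2⟩, fun h => ⟨⟨h.1, ?_⟩, h.2⟩⟩
          rw [h.2]; exact hu
      · rw [if_neg hu]
        have : {t ∈ {t ∈ childClass A S B (deg ρ) i | t.leafLabels.card < n} |
            t.leafLabels = u.val} = ∅ := by
          ext t
          simp only [Set.mem_ofPred_eq, Set.mem_empty_iff_false, iff_false]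
          rintro ⟨⟨-, h1⟩, h2⟩
          rw [h2] at h1; exact hu h1
        rw [this]; simp
    have h1 := restrictedTrees_finite_and_ncard (S := S) (hm ρ) ⟨fun _ => hA, fun _ => hB⟩
      (hdeg ρ) s (key s hn).1
    have h2 := restrictedTrees_finite_and_ncard (S := S) (hm ρ) ⟨fun _ => hA, fun _ => hB⟩
      (hdeg ρ) (Finset.Icc 1 n) (key _ (by simp)).1
    refine ⟨h1.1, ?_⟩
    rw [treeCount, h1.2, h2.2, (key s hn).2, (key _ (by simp)).2, hn, Nat.card_Icc,
      Nat.add_sub_cancel]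

theorem treeCount_eq [∀ ρ, Decidable (q ρ)] (hm : ∀ ρ, 2 ≤ deg ρ) (hA : 0 ∈ A) (hB : 0 ∈ B)
    (hdeg : ∀ ρ k, 2 ≤ k → (((¬ρ → k ∈ A) ∧ (ρ → k ∈ B)) ↔ k = deg ρ ∧ q ρ)) (ρ : Prop) (n : ℕ) :
    treeCount A S B ρ n = (if n = 1 then 1 else 0) +
      if q ρ then seqCount (fun i => treeCount A S B (i = 0 ∧ deg ρ ∈ S)) (deg ρ) n else 0 := by
  have h := orderedSeqs_finite_and_ncard (K := childClass A S B (deg ρ))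
    (fun _ => leafLabels_ne_zero_of_mem)
    (fun i => treeCount_spec hm hA hB hdeg (i = 0 ∧ deg ρ ∈ S)) (deg ρ) (Finset.Icc 1 n)
  rw [treeCount, (restrictedTrees_finite_and_ncard (S := S) (hm ρ) ⟨fun _ => hA, fun _ => hB⟩
      (hdeg ρ) (Finset.Icc 1 n) h.1).2, h.2, Nat.card_Icc, Nat.add_sub_cancel]

theorem forestCount_eq_labelledMultisets_ncard (n k : ℕ) :
    forestCount A S B n k = (labelledMultisets leafLabels (restrictedTrees A S B False) k
      (Finset.Icc 1 n)).ncard := by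
  rw [forestCount]
  congr 1
  ext F
  simp only [forestsH, labelledMultisets, restrictedTrees, Set.mem_ofPred_eq]
  exact ⟨fun ⟨⟨h1, h2, h3⟩, h4⟩ => ⟨h1, h2, fun t ht => ⟨h3 t ht, h4 t ht⟩⟩,
    fun ⟨h1, h2, h3⟩ => ⟨⟨h1, h2, fun t ht => (h3 t ht).1⟩, fun t ht => (h3 t ht).2⟩⟩

theorem forestCount_eq_seqCount (hm : ∀ ρ, 2 ≤ deg ρ) (hA : 0 ∈ A) (hB : 0 ∈ B)
    (hdeg : ∀ ρ k, 2 ≤ k → (((¬ρ → k ∈ A) ∧ (ρ → k ∈ B)) ↔ k = deg ρ ∧ q ρ)) (n k : ℕ) :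
    forestCount A S B n k = seqCount (fun _ => treeCount A S B False) k n := by
  rw [forestCount_eq_labelledMultisets_ncard, labelledMultisets_ncard leafLabels_ne_zero_of_mem
    (treeCount_spec hm hA hB hdeg False), Nat.card_Icc, Nat.add_sub_cancel]

/-! ### Leaf counts modulo d -/

/-- If m subtrees each have 1 leaf modulo d, together they have m ≡ 1. -/
theorem card_leafLabels_modEq {d : ℕ} (hA : ∀ k ∈ A, 2 ≤ k → k ≡ 1 [MOD d])
    (hB : ∀ k ∈ B, 2 ≤ k → k ≡ 1 [MOD d]) {t : LeafLabeledTree} {ρ : Prop}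
    (ht : t ∈ restrictedTrees A S B ρ) : t.leafLabels.card ≡ 1 [MOD d] := by
  induction t generalizing ρ with
  | leaf a => exact Nat.ModEq.rfl
  | node m c ih =>
    have hm : m ≡ 1 [MOD d] := by
      by_cases hρ : ρ
      · exact hB m (ht.2.2.1 hρ) ht.1.1
      · exact hA m (ht.2.1 hρ) ht.1.1
    simp only [leafLabels, Multiset.card_sum]
    rw [← ZMod.natCast_eq_natCast_iff] at hm ⊢
    have : ∀ i, (((c i).leafLabels.card : ℕ) : ZMod d) = ((1 : ℕ) : ZMod d) := fun i =>
      (ZMod.natCast_eq_natCast_iff _ _ _).2 (ih i ⟨ht.1.2.2 i, ht.2.2.2 i⟩)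
    rw [Nat.cast_sum, Finset.sum_congr rfl fun i _ => this i]
    simpa using hm

theorem forestCount_eq_zero {d : ℕ} (hA : ∀ k ∈ A, 2 ≤ k → k ≡ 1 [MOD d])
    (hB : ∀ k ∈ B, 2 ≤ k → k ≡ 1 [MOD d]) {n k : ℕ} (h : ¬ n ≡ k [MOD d]) :
    forestCount A S B n k = 0 := by
  rw [forestCount_eq_labelledMultisets_ncard]
  refine (congrArg Set.ncard (Set.eq_empty_of_forall_notMem ?_)).trans (Set.ncard_empty _)
  rintro F ⟨hk, hsum, hF⟩
  have key : ∀ F : Multiset LeafLabeledTree, (∀ t ∈ F, t ∈ restrictedTrees A S B False) →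
      (F.map leafLabels).sum.card ≡ F.card [MOD d] := by
    intro F
    induction F using Multiset.induction with
    | empty => intro; exact Nat.ModEq.rfl
    | cons t F ih =>
      intro hF
      rw [Multiset.map_cons, Multiset.sum_cons, Multiset.card_add, Multiset.card_cons, add_comm]
      exact (ih fun t ht => hF t (Multiset.mem_cons_of_mem ht)).add
        (card_leafLabels_modEq hA hB (hF t (Multiset.mem_cons_self _ _)))
  refine h ?_
  have := key F hF
  rw [hsum, hk] at this
  simpa using this

end LeafLabeledTree

/-! ### Exponential generating functions -/

open PowerSeries in
/-- The exponential generating function of `a` in which the `n`-th coefficient has the weight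
`ζ ^ (n - j)`. -/
noncomputable def weightedEGF (ζ : ℂ) (j : ℕ) (a : ℕ → ℕ) : ℂ⟦X⟧ :=
  mk fun n => ζ ^ n / ζ ^ j * (a n / (n.factorial : ℂ))

section PowerSeries

open PowerSeries

variable {ζ : ℂ}

theorem coeff_weightedEGF (j : ℕ) (a : ℕ → ℕ) (n : ℕ) :
    coeff n (weightedEGF ζ j a) = ζ ^ n / ζ ^ j * (a n / (n.factorial : ℂ)) :=
  coeff_mk _ _

theorem constantCoeff_weightedEGF {a : ℕ → ℕ} (ha : a 0 = 0) (j : ℕ) :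
    constantCoeff (weightedEGF ζ j a) = 0 := by
  rw [← coeff_zero_eq_constantCoeff_apply, coeff_weightedEGF, ha]; simp

/-- Used with c = -1: replacing one tree by d+1 trees shifts the normalisation by d and so changes
the sign. -/
theorem weightedEGF_eq_smul (hζ : ζ ≠ 0) {j d : ℕ} {c : ℂ} (hc : ζ ^ d = c) (a : ℕ → ℕ) :
    weightedEGF ζ j a = c • weightedEGF ζ (j + d) a := by
  ext n
  rw [map_smul, coeff_weightedEGF, coeff_weightedEGF, smul_eq_mul, ← hc, pow_add]
  field_simp

theorem weightedEGF_seqCount_zero (κ : ℕ → ℕ → ℕ) : weightedEGF ζ 0 (seqCount κ 0) = 1 := by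
  ext n
  rw [coeff_weightedEGF, coeff_one]
  by_cases hn : n = 0 <;> simp [seqCount, hn]

/-- Differentiation removes the largest label, which sits in the last object; the other labels are
distributed freely between that object and the first j. The weights match because the exponent n - j
is additive over the objects. -/
theorem derivative_weightedEGF_seqCount (hζ : ζ ≠ 0) (κ : ℕ → ℕ → ℕ) (j : ℕ) :
    d⁄dX ℂ (weightedEGF ζ (j + 1) (seqCount κ (j + 1))) =
      d⁄dX ℂ (weightedEGF ζ 1 (κ j)) * weightedEGF ζ j (seqCount κ j) := by
  ext n
  rw [coeff_derivative, coeff_mul, Finset.Nat.sum_antidiagonal_eq_sum_range_succ_mk,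
    coeff_weightedEGF, seqCount, Nat.cast_sum, Finset.sum_div, Finset.mul_sum, Finset.sum_mul]
  refine Finset.sum_congr rfl fun i hi => ?_
  obtain ⟨k, rfl⟩ := Nat.exists_eq_add_of_le (Nat.lt_succ_iff.1 (Finset.mem_range.1 hi))
  simp only [coeff_derivative, coeff_weightedEGF, Nat.add_sub_cancel_left]
  rw [Nat.cast_mul, Nat.cast_mul, Nat.cast_choose ℂ (Nat.le_add_right i k),
    Nat.add_sub_cancel_left, Nat.factorial_succ, Nat.factorial_succ]
  have h1 : ((i : ℂ) + 1) ≠ 0 := Nat.cast_add_one_ne_zero i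
  have h2 : ((i : ℂ) + k + 1) ≠ 0 := by exact_mod_cast Nat.cast_add_one_ne_zero (R := ℂ) (i + k)
  have h3 : ∀ n : ℕ, (n.factorial : ℂ) ≠ 0 := fun n => Nat.cast_ne_zero.2 n.factorial_ne_zero
  have h4 := h3 (i + k)
  have h5 := h3 i
  have h6 := h3 k
  push_cast
  field_simp
  ring

/-- The divided powers T^j/j! solve the same recursion with the same constant terms. -/
theorem eq_smul_pow_of_derivative {T : ℂ⟦X⟧} (hT : constantCoeff T = 0) {M : ℕ → ℂ⟦X⟧}
    (hM : M 0 = 1) (hM' : ∀ j, d⁄dX ℂ (M (j + 1)) = d⁄dX ℂ T * M j)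
    (hM0 : ∀ j, constantCoeff (M (j + 1)) = 0) (j : ℕ) :
    M j = (j.factorial : ℂ)⁻¹ • T ^ j := by
  induction j with
  | zero => simp [hM]
  | succ j ih =>
    refine derivative.ext ?_ (by simp [hM0, hT])
    have h1 : ((j : ℂ) + 1) ≠ 0 := Nat.cast_add_one_ne_zero j
    have h2 : (j.factorial : ℂ) ≠ 0 := Nat.cast_ne_zero.2 j.factorial_ne_zero
    rw [hM', ih, Derivation.map_smul, derivative_pow, Nat.factorial_succ, Nat.add_sub_cancel]
    have h3 : ((j + 1 : ℕ) : ℂ⟦X⟧) = C ((j : ℂ) + 1) := by simp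
    rw [h3, smul_eq_C_mul, smul_eq_C_mul]
    have h4 : C (((j + 1) * j.factorial : ℕ) : ℂ)⁻¹ * C ((j : ℂ) + 1) =
        C (j.factorial : ℂ)⁻¹ := by
      rw [← map_mul]; congr 1; push_cast; field_simp
    rw [← h4]
    ring

theorem weightedEGF_seqCount_const (hζ : ζ ≠ 0) {κ : ℕ → ℕ} (hκ : κ 0 = 0) (j : ℕ) :
    weightedEGF ζ j (seqCount (fun _ => κ) j) = (j.factorial : ℂ)⁻¹ • weightedEGF ζ 1 κ ^ j :=
  eq_smul_pow_of_derivative (M := fun j => weightedEGF ζ j (seqCount (fun _ => κ) j))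
    (constantCoeff_weightedEGF hκ 1) (weightedEGF_seqCount_zero _)
    (fun j => derivative_weightedEGF_seqCount hζ _ j)
    (fun j => constantCoeff_weightedEGF (by simp [seqCount]) _) j

/-! ### Functional equation and compositional inverses -/

theorem hasSubst_of_constantCoeff {T : ℂ⟦X⟧} (hT : constantCoeff T = 0) : HasSubst T :=
  HasSubst.of_constantCoeff_zero' hT

theorem constantCoeff_subst_of_eq_zero {f T : ℂ⟦X⟧} (hf : constantCoeff f = 0)
    (hT : constantCoeff T = 0) : constantCoeff (f.subst T) = 0 :=
  constantCoeff_subst_eq_zero hT f hf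

/-- A functional equation for `T` in terms of iterated integrals with respect to `T` implies that
`T` is a right inverse of `f`. -/
theorem subst_eq_X_of_iterated_integrals {d : ℕ} (hd : 1 ≤ d) {f E T : ℂ⟦X⟧} {g M : ℕ → ℂ⟦X⟧}
    (hT : constantCoeff T = 0) (hg1 : g 1 = f - E) (hgd : g (d + 1) = f - X)
    (hg' : ∀ j, 1 ≤ j → d⁄dX ℂ (g (j + 1)) = g j) (hg0 : ∀ j, 1 ≤ j → constantCoeff (g j) = 0)
    (hM1 : M 1 = X - E.subst T) (hMd : M (d + 1) = X - T)
    (hM' : ∀ j, 1 ≤ j → d⁄dX ℂ (M (j + 1)) = d⁄dX ℂ T * M j)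
    (hM0 : ∀ j, 1 ≤ j → constantCoeff (M j) = 0) : f.subst T = X := by
  have hS := hasSubst_of_constantCoeff hT
  set D : ℕ → ℂ⟦X⟧ := fun j => (g j).subst T - M j with hD
  have hsub : ∀ a b : ℂ⟦X⟧, (a - b).subst T = a.subst T - b.subst T := fun a b => subst_sub hS a b
  have hD1 : D 1 = f.subst T - X := by simp only [hD, hg1, hM1, hsub]; ring
  have hDd : D (d + 1) = f.subst T - X := by
    simp only [hD, hgd, hMd, hsub]
    have : (X : ℂ⟦X⟧).subst T = T := subst_X hS
    rw [this]; ring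
  have hD' : ∀ j, 1 ≤ j → d⁄dX ℂ (D (j + 1)) = d⁄dX ℂ T * D j := by
    intro j hj
    simp only [hD, map_sub, derivative_subst hS, hg' j hj, hM' j hj]
    ring
  have hD0 : ∀ j, 1 ≤ j → constantCoeff (D j) = 0 := by
    intro j hj
    simp only [hD, map_sub, hM0 j hj, constantCoeff_subst_of_eq_zero (hg0 j hj) hT, sub_zero]
  -- Integrating T'·D_j with zero constant term raises the order of vanishing by at least one.
  have hstep : ∀ N j, 1 ≤ j → X ^ N ∣ D j → X ^ (N + 1) ∣ D (j + 1) := by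
    intro N j hj h
    rw [X_pow_dvd_iff]
    intro m hm
    rcases m with _ | m
    · rw [coeff_zero_eq_constantCoeff_apply]; exact hD0 _ (by omega)
    · have h1 : coeff m (d⁄dX ℂ (D (j + 1))) = 0 := by
        rw [hD' j hj]
        exact X_pow_dvd_iff.1 (h.mul_left _) m (by omega)
      rw [coeff_derivative] at h1
      exact (mul_eq_zero.1 h1).resolve_right (Nat.cast_add_one_ne_zero m)
  have hiter : ∀ N i, X ^ N ∣ D 1 → X ^ (N + i) ∣ D (1 + i) := by
    intro N i h
    induction i with
    | zero => exact h
    | succ i ih => exact hstep (N + i) (1 + i) (by omega) ih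
  -- After d ≥ 1 integrations D_1 returns as D_{d+1} = D_1, so its order of vanishing is unbounded.
  have hall : ∀ N, X ^ N ∣ D 1 := by
    intro N
    induction N with
    | zero => simp
    | succ N ih =>
      have := hiter N d ih
      rw [add_comm 1 d, hDd, ← hD1] at this
      exact (pow_dvd_pow X (show N + 1 ≤ N + d by omega)).trans this
  have : D 1 = 0 := by
    ext n
    exact X_pow_dvd_iff.1 (hall (n + 1)) n (Nat.lt_succ_self n)
  rw [hD1] at this
  exact sub_eq_zero.1 this

/-- A left inverse S of f exists because the linear coefficient is invertible, and S = S∘(f∘T) =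
(S∘f)∘T = T. -/
theorem subst_eq_X_comm {f T : ℂ⟦X⟧} (hf : constantCoeff f = 0) (hf1 : coeff 1 f ≠ 0)
    (hT : constantCoeff T = 0) (h : f.subst T = X) : T.subst f = X := by
  obtain ⟨S, hS⟩ : ∃ S : ℂ⟦X⟧, S.subst f = X :=
    let _ : Invertible (coeff 1 f) := invertibleOfNonzero hf1
    ⟨f.substInv, subst_substInv_left f hf⟩
  have hfS := hasSubst_of_constantCoeff hf
  have hTS := hasSubst_of_constantCoeff hT
  have h1 : PowerSeries.subst T (PowerSeries.subst f S) =
      PowerSeries.subst (PowerSeries.subst T f) S := subst_comp_subst_apply hfS hTS S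
  have h2 : (X : ℂ⟦X⟧).subst T = T := subst_X hTS
  have h3 : S.subst (X : ℂ⟦X⟧) = S := X_subst S
  rw [hS, h, h2, h3] at h1
  rw [h1, hS]

end PowerSeries

/-! ### Inverse matrices -/

/-- The usual B' = B'(AB) = (B'A)B = B, with row-finiteness confining both summations to the finite
sets J and I. -/
theorem IsInverseMatrix.unique {A B B' : Matrix ℕ+ ℕ+ ℤ} (h : IsInverseMatrix A B)
    (h' : IsInverseMatrix A B') : B' = B := by
  classical
  ext n k
  set J := (h'.rowFinite_right n).toFinset with hJ
  -- The index n is added so that the final Kronecker sum over I picks out B n k.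
  set I := insert n (J.biUnion fun j => (h.rowFinite_left j).toFinset) with hI
  have hAB : ∀ j ∈ J, ∑ i ∈ I, A j i * B i k = if j = k then 1 else 0 := by
    intro j hj
    rw [← h.mul_right j k]
    refine (finsum_eq_sum_of_support_subset _ fun i hi => ?_).symm
    have : A j i ≠ 0 := fun h0 => hi (by simp [h0])
    simp only [hI, Finset.coe_insert, Finset.coe_biUnion]
    exact Or.inr (Set.mem_biUnion hj (by simpa using this))
  have hBA : ∀ i, ∑ j ∈ J, B' n j * A j i = if n = i then 1 else 0 := by
    intro i
    rw [← h'.mul_left n i]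
    refine (finsum_eq_sum_of_support_subset _ fun j hj => ?_).symm
    have : B' n j ≠ 0 := fun h0 => hj (by simp [h0])
    simpa [hJ] using this
  calc B' n k = ∑ j ∈ J, B' n j * (if j = k then 1 else 0) := by
        simp only [mul_ite, mul_one, mul_zero, Finset.sum_ite_eq']
        split_ifs with hk
        · rfl
        · by_contra h0
          exact hk (by simpa [hJ] using h0)
    _ = ∑ j ∈ J, ∑ i ∈ I, B' n j * A j i * B i k := by
        refine Finset.sum_congr rfl fun j hj => ?_
        rw [← hAB j hj, Finset.mul_sum]
        simp only [mul_assoc]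
    _ = ∑ i ∈ I, (if n = i then 1 else 0) * B i k := by
        rw [Finset.sum_comm]
        refine Finset.sum_congr rfl fun i _ => ?_
        rw [← hBA i, Finset.sum_mul]
    _ = B n k := by simp [hI]

theorem IsInverseMatrix.existsUnique_and_eq {R : Set ℕ} {B : Matrix ℕ+ ℕ+ ℤ}
    (h : IsInverseMatrix (restrictedStirlingMatrix R) B) :
    (∃! B, IsInverseMatrix (restrictedStirlingMatrix R) B) ∧
      ∀ n k, inverseRestrictedStirling R n k = B n k := by
  refine ⟨⟨B, h, fun B' h' => h.unique h'⟩, fun n k => ?_⟩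
  have hex : ∃ B, IsInverseMatrix (restrictedStirlingMatrix R) B := ⟨B, h⟩
  rw [inverseRestrictedStirling, dif_pos hex, h.unique hex.choose_spec]

theorem finsum_pnat_eq_finsum_nat {M : Type*} [AddCommMonoid M] {g : ℕ → M} (h0 : g 0 = 0) :
    ∑ᶠ j : ℕ+, g j = ∑ᶠ j : ℕ, g j := by
  rw [← finsum_mem_range (f := g) (g := fun j : ℕ+ => (j : ℕ)) PNat.coe_injective,
    ← finsum_mem_univ (f := g)]
  refine finsum_mem_inter_support_eq' _ _ _ fun j hj => ?_
  simp only [Set.mem_univ, iff_true]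
  have hj0 : j ≠ 0 := fun h => hj (by rw [h, h0])
  exact ⟨⟨j, Nat.pos_of_ne_zero hj0⟩, rfl⟩

/-! ### Arrays of powers of a series -/

open PowerSeries in
theorem coeff_pow_eq_zero_of_lt {f : ℂ⟦X⟧} (hf : constantCoeff f = 0) {n k : ℕ} (h : n < k) :
    coeff n (f ^ k) = 0 :=
  X_pow_dvd_iff.1 (pow_dvd_pow_of_dvd (X_dvd_iff.2 hf) k) n h

open PowerSeries in
/-- The matrix `A` is the exponential Riordan-type array of the powers of `f`. -/
def IsIterationMatrix (A : Matrix ℕ+ ℕ+ ℤ) (f : ℂ⟦X⟧) : Prop :=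
  ∀ n k : ℕ+, (A n k : ℂ) =
    ((n : ℕ).factorial : ℂ) * (((k : ℕ).factorial : ℂ)⁻¹ * coeff (n : ℕ) (f ^ (k : ℕ)))

open PowerSeries in
theorem IsIterationMatrix.rowFinite {A : Matrix ℕ+ ℕ+ ℤ} {f : ℂ⟦X⟧} (hA : IsIterationMatrix A f)
    (hf : constantCoeff f = 0) (n : ℕ+) : {j | A n j ≠ 0}.Finite := by
  refine (Set.finite_Iic n).subset fun j hj => ?_
  by_contra hlt
  refine hj ?_
  have := hA n j
  rw [coeff_pow_eq_zero_of_lt hf (by simpa using hlt)] at this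
  simpa using this

-- Expanding (g∘f)^k = g^k∘f gives Σ_j [x^j]g^k · [x^n]f^j; the factors j! of the two arrays cancel.
-- The order is reversed: the array of f times that of g belongs to g∘f.
open PowerSeries in
theorem IsIterationMatrix.mul {A B : Matrix ℕ+ ℕ+ ℤ} {f g : ℂ⟦X⟧} (hA : IsIterationMatrix A f)
    (hB : IsIterationMatrix B g) (hf : constantCoeff f = 0) (hg : constantCoeff g = 0)
    (h : g.subst f = X) (n k : ℕ+) :
    ∑ᶠ j, A n j * B j k = if n = k then 1 else 0 := by
  have hS := hasSubst_of_constantCoeff hf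
  have hcoeff : coeff (n : ℕ) ((g ^ (k : ℕ)).subst f) = coeff (n : ℕ) (X ^ (k : ℕ) : ℂ⟦X⟧) := by
    have : (g ^ (k : ℕ)).subst f = (g.subst f) ^ (k : ℕ) := subst_pow hS _ _
    rw [this, h]
  rw [coeff_subst' hS, coeff_X_pow] at hcoeff
  apply Int.cast_injective (α := ℂ)
  have hcast : ((∑ᶠ j, A n j * B j k : ℤ) : ℂ) = ∑ᶠ j, ((A n j * B j k : ℤ) : ℂ) :=
    (Int.castAddHom ℂ).map_finsum_of_injective Int.cast_injective _
  have hterm : ∀ j : ℕ+, ((A n j * B j k : ℤ) : ℂ) =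
      (((n : ℕ).factorial : ℂ) * ((k : ℕ).factorial : ℂ)⁻¹) •
        (coeff (j : ℕ) (g ^ (k : ℕ)) • coeff (n : ℕ) (f ^ (j : ℕ))) := by
    intro j
    have hj : ((j : ℕ).factorial : ℂ) ≠ 0 := Nat.cast_ne_zero.2 (Nat.factorial_ne_zero _)
    rw [Int.cast_mul, hA n j, hB j k, smul_eq_mul, smul_eq_mul]
    field_simp
  rw [hcast, finsum_congr hterm, ← smul_finsum,
    finsum_pnat_eq_finsum_nat
      (g := fun j => coeff j (g ^ (k : ℕ)) • coeff (n : ℕ) (f ^ j)) ?_, hcoeff]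
  · have hk : ((k : ℕ).factorial : ℂ) ≠ 0 := Nat.cast_ne_zero.2 (Nat.factorial_ne_zero _)
    by_cases hnk : n = k
    · subst hnk; simp [hk]
    · simp [hnk]
  · have : coeff 0 (g ^ (k : ℕ)) = 0 := coeff_pow_eq_zero_of_lt hg k.pos
    simp only [this, zero_smul]

open PowerSeries in
theorem IsIterationMatrix.isInverseMatrix {A B : Matrix ℕ+ ℕ+ ℤ} {f g : ℂ⟦X⟧}
    (hA : IsIterationMatrix A f) (hB : IsIterationMatrix B g) (hf : constantCoeff f = 0)
    (hf1 : coeff 1 f ≠ 0) (hg : constantCoeff g = 0) (h : f.subst g = X) :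
    IsInverseMatrix A B where
  rowFinite_left := hA.rowFinite hf
  rowFinite_right := hB.rowFinite hg
  mul_right := hA.mul hB hf hg (subst_eq_X_comm hf hf1 hg h)
  mul_left := hB.mul hA hg hf h

/-! ### Assembly -/

section Assembly

open PowerSeries

open Classical in
/-- The exponential generating function of the sizes `j + i * d` for `i ∈ I`. -/
noncomputable def progressionEGF (d : ℕ) (I : Set ℕ) (j : ℕ) : ℂ⟦X⟧ :=
  mk fun n => if ∃ i ∈ I, n = j + i * d then (n.factorial : ℂ)⁻¹ else 0

theorem coeff_progressionEGF (d : ℕ) (I : Set ℕ) (j n : ℕ) {P : Prop} [Decidable P]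
    (hP : (∃ i ∈ I, n = j + i * d) ↔ P) :
    coeff n (progressionEGF d I j) = if P then (n.factorial : ℂ)⁻¹ else 0 := by
  classical
  rw [progressionEGF, coeff_mk]
  exact if_congr hP rfl rfl

theorem derivative_progressionEGF (d : ℕ) (I : Set ℕ) (j : ℕ) :
    d⁄dX ℂ (progressionEGF d I (j + 1)) = progressionEGF d I j := by
  classical
  ext n
  rw [coeff_derivative, coeff_progressionEGF d I j n Iff.rfl,
    coeff_progressionEGF d I (j + 1) (n + 1) (P := ∃ i ∈ I, n = j + i * d)
      (exists_congr fun i => and_congr_right fun _ => by omega)]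
  split_ifs
  · have h1 : ((n : ℂ) + 1) ≠ 0 := Nat.cast_add_one_ne_zero n
    rw [Nat.factorial_succ]; push_cast
    field_simp
  · simp

theorem constantCoeff_progressionEGF (d : ℕ) (I : Set ℕ) {j : ℕ} (hj : 1 ≤ j) :
    constantCoeff (progressionEGF d I j) = 0 := by
  rw [← coeff_zero_eq_constantCoeff_apply, progressionEGF, coeff_mk, if_neg]
  rintro ⟨i, -, h⟩; omega

/-- Set partitions carry no sign, so the power formula is applied with ζ = 1. -/
theorem isIterationMatrix_restrictedStirlingMatrix (d : ℕ) (J : Set ℕ) :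
    IsIterationMatrix (restrictedStirlingMatrix {m | ∃ i ∈ J, m = 1 + i * d})
      (progressionEGF d J 1) := by
  classical
  intro n k
  set R := {m | ∃ i ∈ J, m = 1 + i * d} with hR
  have hf : progressionEGF d J 1 =
      weightedEGF 1 1 (fun i => if i ≠ 0 ∧ i ∈ R then 1 else 0) := by
    ext n
    rw [coeff_weightedEGF, progressionEGF, coeff_mk]
    have h : (n ≠ 0 ∧ n ∈ R) ↔ ∃ i ∈ J, n = 1 + i * d :=
      ⟨fun h => h.2, fun h => ⟨by obtain ⟨i, -, h⟩ := h; omega, h⟩⟩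
    simp only [h]
    split_ifs <;> simp
  have h := congrArg (coeff (n : ℕ)) (weightedEGF_seqCount_const (ζ := 1) one_ne_zero
    (κ := fun i => if i ≠ 0 ∧ i ∈ R then 1 else 0) (by simp) k)
  rw [coeff_weightedEGF, coeff_smul, smul_eq_mul] at h
  have hn : ((n : ℕ).factorial : ℂ) ≠ 0 := Nat.cast_ne_zero.2 (Nat.factorial_ne_zero _)
  rw [hf, ← h, restrictedStirlingMatrix, restrictedStirling_eq_seqCount]
  simp only [one_pow, Int.cast_natCast]
  field_simp

variable {d : ℕ} {A S B : Set ℕ} {ρ : Prop} {deg : Prop → ℕ} {q : Prop → Prop}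

/-- The matrix of signed forest counts. -/
noncomputable def signedForestMatrix (d : ℕ) (A S B : Set ℕ) : Matrix ℕ+ ℕ+ ℤ := fun n k =>
  if (n : ℕ) ≡ (k : ℕ) [MOD d] then
    (-1) ^ (((n : ℕ) - (k : ℕ)) / d) * (forestCount A S B n k : ℤ) else 0

open LeafLabeledTree

theorem treeCount_zero : treeCount A S B ρ 0 = 0 := by
  rw [treeCount, Set.eq_empty_of_forall_notMem (s := {t | _}), Set.ncard_empty]
  rintro t ⟨h1, h2⟩
  exact leafLabels_ne_zero_of_mem t h1 (by simpa using h2)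

theorem isIterationMatrix_signedForestMatrix (hm : ∀ ρ, 2 ≤ deg ρ) (hA : 0 ∈ A) (hB : 0 ∈ B)
    (hdeg : ∀ ρ k, 2 ≤ k → (((¬ρ → k ∈ A) ∧ (ρ → k ∈ B)) ↔ k = deg ρ ∧ q ρ))
    (hmodA : ∀ k ∈ A, 2 ≤ k → k ≡ 1 [MOD d]) (hmodB : ∀ k ∈ B, 2 ≤ k → k ≡ 1 [MOD d])
    {ζ : ℂ} (hζ0 : ζ ≠ 0) (hζ : ζ ^ d = -1) :
    IsIterationMatrix (signedForestMatrix d A S B) (weightedEGF ζ 1 (treeCount A S B False)) := by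
  intro n k
  have hn : ((n : ℕ).factorial : ℂ) ≠ 0 := Nat.cast_ne_zero.2 (Nat.factorial_ne_zero _)
  have hk : ((k : ℕ).factorial : ℂ) ≠ 0 := Nat.cast_ne_zero.2 (Nat.factorial_ne_zero _)
  have h := congrArg (coeff (n : ℕ)) (weightedEGF_seqCount_const (ζ := ζ) hζ0
    (κ := treeCount A S B False) treeCount_zero k)
  rw [coeff_weightedEGF, coeff_smul, smul_eq_mul,
    ← forestCount_eq_seqCount hm hA hB hdeg] at h
  rw [← h]
  have hval : ((signedForestMatrix d A S B n k : ℤ) : ℂ) =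
      ζ ^ (n : ℕ) / ζ ^ (k : ℕ) * forestCount A S B n k := by
    -- For n < k the truncated exponent n - k is meaningless, but there is no forest either, as T^k
    -- has order at least k.
    rcases lt_or_ge (n : ℕ) (k : ℕ) with hlt | hle
    · have h0 : forestCount A S B n k = 0 := by
        rw [coeff_pow_eq_zero_of_lt (constantCoeff_weightedEGF treeCount_zero 1) hlt] at h
        simpa [hζ0, hn] using h
      simp [signedForestMatrix, h0]
    · rw [signedForestMatrix]
      split_ifs with hmod
      · obtain ⟨c, hc⟩ := (Nat.modEq_iff_dvd' hle).1 hmod.symm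
        have hd0 : 0 < d := by
          rcases Nat.eq_zero_or_pos d with rfl | h
          · norm_num at hζ
          · exact h
        have hnk : (n : ℕ) = k + d * c := by omega
        rw [hc, Nat.mul_div_cancel_left _ hd0, hnk, pow_add, pow_mul, hζ]
        push_cast
        field_simp
      · simp [forestCount_eq_zero hmodA hmodB hmod]
  rw [hval]
  field_simp

/-- The signed forest matrix inverts the matrix of restricted Stirling numbers provided that the
generating function of the trees with a restricted root satisfies the right equation. -/
theorem isInverseMatrix_signedForestMatrix [∀ ρ, Decidable (q ρ)] (hd : 1 ≤ d) {I J : Set ℕ}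
    (hJ : ∀ i, i ∈ J ↔ i = 0 ∨ ∃ i' ∈ I, i = i' + 1) (hm : ∀ ρ, 2 ≤ deg ρ) (hA : 0 ∈ A)
    (hB : 0 ∈ B)
    (hdeg : ∀ ρ k, 2 ≤ k → (((¬ρ → k ∈ A) ∧ (ρ → k ∈ B)) ↔ k = deg ρ ∧ q ρ))
    (hmodA : ∀ k ∈ A, 2 ≤ k → k ≡ 1 [MOD d]) (hmodB : ∀ k ∈ B, 2 ≤ k → k ≡ 1 [MOD d])
    {ζ : ℂ} (hζ0 : ζ ≠ 0) (hζ : ζ ^ d = -1)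
    (hdegF : deg False = d + 1) (hqF : q False) (hS : d + 1 ∈ S)
    (hL : weightedEGF ζ 1 (treeCount A S B True) =
      X - (progressionEGF d J 1 - progressionEGF d I 1).subst
        (weightedEGF ζ 1 (treeCount A S B False))) :
    IsInverseMatrix (restrictedStirlingMatrix {m | ∃ i ∈ J, m = 1 + i * d})
      (signedForestMatrix d A S B) := by
  set T := weightedEGF ζ 1 (treeCount A S B False) with hT
  have hT0 : constantCoeff T = 0 := constantCoeff_weightedEGF treeCount_zero 1
  -- Children of a node with d+1 children: the left-most is restricted, the others are not.
  set κ : ℕ → ℕ → ℕ := fun i => treeCount A S B (i = 0 ∧ d + 1 ∈ S) with hκ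
  have hκ0 : κ 0 = treeCount A S B True := by simp [hκ, hS]
  have hκs : ∀ i, κ (i + 1) = treeCount A S B False := by simp [hκ]
  have hM0 : ∀ j, 1 ≤ j → constantCoeff (weightedEGF ζ j (seqCount κ j)) = 0 := by
    intro j hj
    obtain ⟨j, rfl⟩ := Nat.exists_eq_add_of_le' hj
    exact constantCoeff_weightedEGF (by simp [seqCount]) _
  refine (isIterationMatrix_restrictedStirlingMatrix d J).isInverseMatrix
    (isIterationMatrix_signedForestMatrix hm hA hB hdeg hmodA hmodB hζ0 hζ)
    (constantCoeff_progressionEGF d J le_rfl) ?_ hT0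
    (subst_eq_X_of_iterated_integrals hd (g := progressionEGF d I)
      (E := progressionEGF d J 1 - progressionEGF d I 1)
      (M := fun j => weightedEGF ζ j (seqCount κ j)) hT0 (by ring) ?_
      (fun j _ => derivative_progressionEGF d I j)
      (fun j hj => constantCoeff_progressionEGF d I hj) ?_ ?_ ?_ hM0)
  · rw [progressionEGF, coeff_mk, if_pos ⟨0, (hJ 0).2 (Or.inl rfl), by simp⟩]
    simp
  · ext n
    rw [map_sub, progressionEGF, progressionEGF, coeff_mk, coeff_mk, coeff_X]
    by_cases hn : n = 1
    · subst hn
      rw [if_neg, if_pos ⟨0, (hJ 0).2 (Or.inl rfl), by simp⟩]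
      · simp
      · rintro ⟨i, -, h⟩; omega
    · have h : (∃ i ∈ I, n = d + 1 + i * d) ↔ ∃ i ∈ J, n = 1 + i * d := by
        constructor
        · rintro ⟨i, hi, rfl⟩
          exact ⟨i + 1, (hJ _).2 (Or.inr ⟨i, hi, rfl⟩), by ring⟩
        · rintro ⟨i, hi, rfl⟩
          rcases (hJ i).1 hi with rfl | ⟨i', hi', rfl⟩
          · simp at hn
          · exact ⟨i', hi', by ring⟩
      classical
      have h1 := coeff_progressionEGF d I (d + 1) n h
      have h2 := coeff_progressionEGF d J 1 n Iff.rfl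
      rw [progressionEGF, coeff_mk] at h1 h2
      rw [h1, h2, if_neg hn, sub_zero]
  · rw [← hL]
    refine derivative.ext ?_ ?_
    · show d⁄dX ℂ (weightedEGF ζ (0 + 1) (seqCount κ (0 + 1))) = _
      rw [derivative_weightedEGF_seqCount hζ0, weightedEGF_seqCount_zero, mul_one, hκ0]
    · rw [constantCoeff_weightedEGF treeCount_zero]
      exact hM0 1 le_rfl
  -- A tree is a leaf or a root with d+1 subtrees. Passing from normalisation 1 to d+1 multiplies by
  -- ζ^d = -1, whence T = X - M_{d+1}.
  · have h1 : T = X + weightedEGF ζ 1 (seqCount κ (d + 1)) := by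
      ext n
      rw [hT, map_add, coeff_weightedEGF, coeff_weightedEGF, coeff_X,
        treeCount_eq hm hA hB hdeg False n, if_pos hqF, hdegF]
      by_cases hn : n = 1
      · subst hn; simp [hζ0, hκ]
      · simp [hn, hκ]
    rw [weightedEGF_eq_smul hζ0 hζ, add_comm 1 d] at h1
    show _ = X - T
    rw [h1]
    simp
  · intro j hj
    obtain ⟨j, rfl⟩ := Nat.exists_eq_add_of_le' hj
    rw [derivative_weightedEGF_seqCount hζ0, hκs]

/-! ### The finite and infinite restriction sets -/

theorem isInverseMatrix_signedForestMatrix_finite {r d : ℕ} (hr : 1 ≤ r) (hd : 1 ≤ d) :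
    IsInverseMatrix (restrictedStirlingMatrix {m | ∃ i, i < 2 * r ∧ m = 1 + i * d})
      (signedForestMatrix d {0, d + 1} {d + 1} {0, 1 + (2 * r - 1) * d}) := by
  classical
  obtain ⟨ζ, hζ⟩ := IsAlgClosed.exists_pow_nat_eq (-1 : ℂ) hd
  have hζ0 : ζ ≠ 0 := by
    rintro rfl
    rw [zero_pow (by omega)] at hζ
    norm_num at hζ
  set m := 1 + (2 * r - 1) * d with hmdef
  have hrd : d ≤ (2 * r - 1) * d := Nat.le_mul_of_pos_left d (by omega)
  have hmod : ∀ c, 1 + c * d ≡ 1 [MOD d] := fun c => by simp [Nat.ModEq]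
  have hm : ∀ ρ : Prop, 2 ≤ (if ρ then m else d + 1) := by
    intro ρ; split_ifs <;> omega
  have hdeg : ∀ (ρ : Prop) (k : ℕ), 2 ≤ k →
      (((¬ρ → k ∈ ({0, d + 1} : Set ℕ)) ∧ (ρ → k ∈ ({0, m} : Set ℕ))) ↔
        k = (if ρ then m else d + 1) ∧ (fun _ => True) ρ) := by
    intro ρ k hk
    have hk0 : k ≠ 0 := by omega
    by_cases hρ : ρ <;> simp [hρ, hk0]
  have hA : (0 : ℕ) ∈ ({0, d + 1} : Set ℕ) := by simp
  have hB : (0 : ℕ) ∈ ({0, m} : Set ℕ) := by simp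
  refine isInverseMatrix_signedForestMatrix (q := fun _ => True) hd
    (I := {i | i < 2 * r - 1}) (J := {i | i < 2 * r}) ?_ hm hA hB hdeg ?_ ?_ hζ0 hζ (by simp)
    trivial (by simp) ?_
  · intro i
    simp only [Set.mem_ofPred_eq]
    constructor
    · intro hi
      rcases i with _ | i
      · exact Or.inl rfl
      · exact Or.inr ⟨i, by omega, rfl⟩
    · rintro (rfl | ⟨i', hi', rfl⟩) <;> omega
  · rintro k (rfl | rfl) hk
    · omega
    · simp [Nat.ModEq]
  · rintro k (rfl | rfl) hk
    · omega
    · exact hmod _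
  · set t := treeCount {0, d + 1} {d + 1} {0, m} False with ht
    set l := treeCount {0, d + 1} {d + 1} {0, m} True with hl
    have hT0 : constantCoeff (weightedEGF ζ 1 t) = 0 := constantCoeff_weightedEGF treeCount_zero 1
    have hl1 := treeCount_eq (S := {d + 1}) hm hA hB hdeg True
    have ht1 := treeCount_eq (S := {d + 1}) hm hA hB hdeg False
    simp only [if_true, if_false] at hl1 ht1
    have hchild : (fun i => treeCount {0, d + 1} {d + 1} {0, m} (i = 0 ∧ m ∈ ({d + 1} : Set ℕ))) =
        fun _ => t := by
      funext i
      by_cases h : i = 0 ∧ m ∈ ({d + 1} : Set ℕ)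
      -- This happens only for r = 1. The left-most child of a restricted node is then itself
      -- restricted, but both kinds of vertex allow the same arities, so the counts agree.
      · have hmd : m = d + 1 := h.2
        simp only [h, and_self]
        funext n
        rw [ht, hl1, ht1, hmd]
      · simp only [h, ht]
    rw [hchild] at hl1
    -- Only the largest size m of R is missing from the shorter progression.
    have hE : progressionEGF d {i | i < 2 * r} 1 - progressionEGF d {i | i < 2 * r - 1} 1 =
        (m.factorial : ℂ)⁻¹ • X ^ m := by
      ext n
      rw [map_sub, progressionEGF, progressionEGF, coeff_mk, coeff_mk, coeff_smul, coeff_X_pow]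
      by_cases hn : n = m
      · rw [if_pos ⟨2 * r - 1, by simp; omega, hn⟩, if_neg, if_pos hn, hn]
        · simp
        · rintro ⟨i, hi, h⟩
          have h2 : i * d = (2 * r - 1) * d := by omega
          have h3 := Nat.eq_of_mul_eq_mul_right hd h2
          simp only [Set.mem_ofPred_eq] at hi
          omega
      · have h : (∃ i ∈ {i | i < 2 * r}, n = 1 + i * d) ↔
            ∃ i ∈ {i | i < 2 * r - 1}, n = 1 + i * d := by
          constructor
          · rintro ⟨i, hi, h⟩
            refine ⟨i, lt_of_le_of_ne (Nat.le_sub_one_of_lt hi) ?_, h⟩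
            rintro rfl
            exact hn h
          · rintro ⟨i, hi, h⟩
            exact ⟨i, lt_of_lt_of_le hi (Nat.sub_le _ _), h⟩
        simp only [h, hn, sub_self, if_false, smul_zero]
    have hS := hasSubst_of_constantCoeff hT0
    have hsub : ((m.factorial : ℂ)⁻¹ • X ^ m : ℂ⟦X⟧).subst (weightedEGF ζ 1 t) =
        (m.factorial : ℂ)⁻¹ • weightedEGF ζ 1 t ^ m := by
      have h1 : ((m.factorial : ℂ)⁻¹ • X ^ m : ℂ⟦X⟧).subst (weightedEGF ζ 1 t) =
        (m.factorial : ℂ)⁻¹ • ((X ^ m : ℂ⟦X⟧).subst (weightedEGF ζ 1 t)) := subst_smul hS _ _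
      have h2 : (X ^ m : ℂ⟦X⟧).subst (weightedEGF ζ 1 t) =
        ((X : ℂ⟦X⟧).subst (weightedEGF ζ 1 t)) ^ m := subst_pow hS _ _
      have h3 : (X : ℂ⟦X⟧).subst (weightedEGF ζ 1 t) = weightedEGF ζ 1 t := subst_X hS
      rw [h1, h2, h3]
    -- Here the even number 2r of allowed sizes matters: the exponent of -1 is the odd number 2r -
    -- 1, which gives L = X - T^m/m! for the series L of restricted trees.
    have hζm : ζ ^ ((2 * r - 1) * d) = -1 := by
      rw [mul_comm, pow_mul, hζ]
      exact Odd.neg_one_pow ⟨r - 1, by omega⟩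
    rw [hE, hsub, ← weightedEGF_seqCount_const hζ0 (by rw [ht, treeCount_zero])]
    have h1 : weightedEGF ζ 1 l = X + weightedEGF ζ 1 (seqCount (fun _ => t) m) := by
      ext n
      rw [map_add, coeff_weightedEGF, coeff_weightedEGF, coeff_X, hl, hl1]
      by_cases hn : n = 1
      · subst hn; simp [hζ0]
      · simp [hn]
    rw [h1, weightedEGF_eq_smul (j := 1) hζ0 hζm, ← hmdef]
    simp [sub_eq_add_neg]

/-- The full progression is stable under the shift, so I = J and E = 0. The equation for restricted
trees becomes L = X, that is, they are single leaves. -/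
theorem isInverseMatrix_signedForestMatrix_infinite {d : ℕ} (hd : 1 ≤ d) :
    IsInverseMatrix (restrictedStirlingMatrix {m | ∃ i, m = 1 + i * d})
      (signedForestMatrix d {0, d + 1} Set.univ {0}) := by
  classical
  obtain ⟨ζ, hζ⟩ := IsAlgClosed.exists_pow_nat_eq (-1 : ℂ) hd
  have hζ0 : ζ ≠ 0 := by
    rintro rfl
    rw [zero_pow (by omega)] at hζ
    norm_num at hζ
  have hdeg : ∀ (ρ : Prop) (k : ℕ), 2 ≤ k →
      (((¬ρ → k ∈ ({0, d + 1} : Set ℕ)) ∧ (ρ → k ∈ ({0} : Set ℕ))) ↔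
        k = (fun _ : Prop => d + 1) ρ ∧ ¬ρ) := by
    intro ρ k hk
    have hk0 : k ≠ 0 := by omega
    by_cases hρ : ρ <;> simp [hρ, hk0]
  have hR : {m | ∃ i, m = 1 + i * d} = {m | ∃ i ∈ (Set.univ : Set ℕ), m = 1 + i * d} := by
    ext m; simp
  have hm : ∀ _ : Prop, 2 ≤ d + 1 := fun _ => by omega
  rw [hR]
  refine isInverseMatrix_signedForestMatrix hd (I := Set.univ) ?_
    hm (by simp) (by simp) hdeg ?_ ?_ hζ0 hζ rfl not_false (by simp) ?_
  · intro i
    rcases i with _ | i <;> simp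
  · rintro k (rfl | rfl) hk
    · omega
    · simp [Nat.ModEq]
  · rintro k rfl hk
    omega
  · have h0 : (0 : ℂ⟦X⟧).subst (weightedEGF ζ 1 (treeCount {0, d + 1} Set.univ {0} False)) = 0 := by
      have := subst_sub (hasSubst_of_constantCoeff (constantCoeff_weightedEGF (ζ := ζ)
        (treeCount_zero (A := {0, d + 1}) (S := Set.univ) (B := {0}) (ρ := False)) 1))
        (X : ℂ⟦X⟧) (X : ℂ⟦X⟧)
      rwa [sub_self, sub_self] at this
    rw [sub_self, h0, sub_zero]
    ext n
    rw [coeff_weightedEGF, coeff_X, treeCount_eq (S := Set.univ) hm (by simp) (by simp) hdeg True]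
    by_cases hn : n = 1
    · subst hn; simp [hζ0]
    · simp [hn]

end Assembly

theorem corollary1p1 :
    -- the restriction set `{1, 2, …, 2r}`
    (∀ r : ℕ, 1 ≤ r →
      (∃! B, IsInverseMatrix (restrictedStirlingMatrix (Set.Icc 1 (2 * r))) B) ∧
      ∀ n k : ℕ+,
        inverseRestrictedStirling (Set.Icc 1 (2 * r)) n k =
          (-1) ^ ((n : ℕ) - (k : ℕ)) *
            (forestCount {0, 2} {2} {0, 2 * r} n k : ℤ)) ∧
    -- the restriction set `{1, d + 1, 2d + 1, …, 1 + (2r - 1)d}`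
    (∀ r d : ℕ, 1 ≤ r → 2 ≤ d →
      (∃! B, IsInverseMatrix
        (restrictedStirlingMatrix {m | ∃ i, i < 2 * r ∧ m = 1 + i * d}) B) ∧
      ∀ n k : ℕ+,
        ((n : ℕ) ≡ (k : ℕ) [MOD d] →
          inverseRestrictedStirling {m | ∃ i, i < 2 * r ∧ m = 1 + i * d} n k =
            (-1) ^ (((n : ℕ) - (k : ℕ)) / d) *
              (forestCount {0, d + 1} {d + 1}
                {0, 1 + (2 * r - 1) * d} n k : ℤ)) ∧
        (¬ (n : ℕ) ≡ (k : ℕ) [MOD d] →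
          inverseRestrictedStirling {m | ∃ i, i < 2 * r ∧ m = 1 + i * d} n k = 0)) ∧
    -- the restriction set `{1, d + 1, 2d + 1, …}`
    (∀ d : ℕ, 1 ≤ d →
      (∃! B, IsInverseMatrix (restrictedStirlingMatrix {m | ∃ i, m = 1 + i * d}) B) ∧
      ∀ n k : ℕ+,
        ((n : ℕ) ≡ (k : ℕ) [MOD d] →
          inverseRestrictedStirling {m | ∃ i, m = 1 + i * d} n k =
            (-1) ^ (((n : ℕ) - (k : ℕ)) / d) *
              (forestCount {0, d + 1} Set.univ {0} n k : ℤ)) ∧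
        (¬ (n : ℕ) ≡ (k : ℕ) [MOD d] →
          inverseRestrictedStirling {m | ∃ i, m = 1 + i * d} n k = 0)) := by
  have key : ∀ {R A S B : Set ℕ} {d : ℕ},
      IsInverseMatrix (restrictedStirlingMatrix R) (signedForestMatrix d A S B) →
      (∃! B, IsInverseMatrix (restrictedStirlingMatrix R) B) ∧ ∀ n k : ℕ+,
        ((n : ℕ) ≡ (k : ℕ) [MOD d] → inverseRestrictedStirling R n k =
          (-1) ^ (((n : ℕ) - (k : ℕ)) / d) * (forestCount A S B n k : ℤ)) ∧
        (¬ (n : ℕ) ≡ (k : ℕ) [MOD d] → inverseRestrictedStirling R n k = 0) := by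
    intro R A S B d h
    refine ⟨h.existsUnique_and_eq.1, fun n k => ?_⟩
    rw [h.existsUnique_and_eq.2, signedForestMatrix]
    exact ⟨fun hnk => if_pos hnk, fun hnk => if_neg hnk⟩
  refine ⟨fun r hr => ?_, fun r d hr hd =>
    key (isInverseMatrix_signedForestMatrix_finite hr (by omega)), fun d hd =>
    key (isInverseMatrix_signedForestMatrix_infinite hd)⟩
  -- The interval is the finite progression with d = 1, where the congruence condition is void.
  have hR : {m | ∃ i, i < 2 * r ∧ m = 1 + i * 1} = Set.Icc 1 (2 * r) := by
    ext m
    simp only [Set.mem_ofPred_eq, Set.mem_Icc]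
    exact ⟨fun ⟨i, h1, h2⟩ => by omega, fun h => ⟨m - 1, by omega, by omega⟩⟩
  have hm : 1 + (2 * r - 1) * 1 = 2 * r := by omega
  have h := key (isInverseMatrix_signedForestMatrix_finite hr le_rfl)
  rw [hR, hm] at h
  refine ⟨h.1, fun n k => ?_⟩
  simpa using (h.2 n k).1 (Nat.modEq_one)
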